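/- Let $\mathbf{k}$ be a field and let $\mathbf{C}$ be a tensor category over $\mathbf{k}$, that is, a $\mathbf{k}$-linear abelian rigid monoidal category whose tensor product is bilinear on morphisms, whose Hom spaces are finite dimensional, all of whose objects have finite length, and with $\mathrm{End}(\mathbf{1})\cong\mathbf{k}$ as algebras. Assume that $\mathbf{C}$ has only finitely many isomorphism classes of simple objects. Write $X^{\ast}$ and ${}^{\ast}X$ for the left and right duals of $X$, and $X^{\otimes d}$ for its tensor powers, with $X^{\otimes 0}=\mathbf{1}$; a subquotient is understood up to isomorphism and direct sums are finite. Then: (a) Every full additive subcategory $\mathbf{D}\subset\mathbf{C}$ that is closed under subquotients and (binary) tensor products is rigid, i.e. $X^{\ast},{}^{\ast}X\in\mathbf{D}$ for all $X\in\mathbf{D}$; if moreover $\mathbf{D}$ contains a nonzero object, then $\mathbf{1}\in\mathbf{D}$, so that $\mathbf{D}$ is a tensor subcategory. (b) For every $X\in\mathbf{C}$, each of $X^{\ast}$ and ${}^{\ast}X$ is a subquotient of a direct sum of objects $X^{\otimes d}$, $d\in\mathbb{Z}_{\geq 0}$. (c) For every simple $V\in\mathbf{C}$, each of $V^{\ast}$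 and ${}^{\ast}V$ is a subquotient of $V^{\otimes d}$ for some $d\in\mathbb{Z}_{\geq 0}$. (d) If $X\in\mathbf{C}$ is a generator, meaning that every object of $\mathbf{C}$ is a subquotient of a direct sum of tensor products of $X$ and its iterated duals, then every object of $\mathbf{C}$ is a subquotient of a direct sum of tensor powers $X^{\otimes d}$, $d\in\mathbb{Z}_{\geq 0}$. -/

import Mathlib

open CategoryTheory CategoryTheory.Limits CategoryTheory.MonoidalCategory

namespace TensorCat

universe v u

section Abelian

variable {C : Type u} [Category.{v} C] [Abelian C]

/-- `Y` is (isomorphic to) a subquotient of `X`: a quotient of a subobject of `X`. -/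
def IsSubquotient (Y X : C) : Prop :=
  ∃ (Z : C) (i : Z ⟶ X) (p : Z ⟶ Y), Mono i ∧ Epi p

variable (C) in
/-- There are only finitely many isomorphism classes of simple objects in `C`. -/
def FinitelyManySimples : Prop :=
  ∃ (n : ℕ) (S : Fin n → C), ∀ V : C, Simple V → ∃ i, Nonempty (V ≅ S i)

/-- The full subcategory on `P` is additive: it contains a zero object and is closed under
binary direct sums. -/
structure IsAdditiveSubcategory (P : ObjectProperty C) : Prop where
  zero : ∃ Z : C, IsZero Z ∧ P Z
  biprod : ∀ X Y : C, P X → P Y → P (X ⊞ Y)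

/-- The full subcategory on `P` is closed under subquotients formed in `C`. -/
def ClosedUnderSubquotients (P : ObjectProperty C) : Prop :=
  ∀ X Y : C, P X → IsSubquotient Y X → P Y

end Abelian

section Monoidal

variable {C : Type u} [Category.{v} C] [MonoidalCategory C]

/-- The full subcategory on `P` is closed under binary tensor products. -/
def ClosedUnderTensor (P : ObjectProperty C) : Prop :=
  ∀ X Y : C, P X → P Y → P (X ⊗ Y)

/-- The tensor product of a list of objects; the empty product is the unit object. -/
def tensorList : List C → C
  | [] => 𝟙_ C
  | X :: L => X ⊗ tensorList L

/-- The tensor power `X^{⊗ d}`, with `X^{⊗ 0}` the unit object. -/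
def tensorPow (X : C) (d : ℕ) : C := tensorList (List.replicate d X)

/-- The iterated (left and right) duals of `X`, including `X` itself. -/
inductive IsIteratedDual [RigidCategory C] (X : C) : C → Prop
  | self : IsIteratedDual X X
  | right (Y : C) : IsIteratedDual X Y → IsIteratedDual X (Yᘁ)
  | left (Y : C) : IsIteratedDual X Y → IsIteratedDual X (ᘁY : C)

end Monoidal

section Tensor

attribute [local instance] Abelian.hasFiniteBiproducts

variable {C : Type u} [Category.{v} C] [Abelian C] [MonoidalCategory C]

/-- `Y` is a subquotient of a (finite) direct sum of tensor powers of `X`. -/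
def IsSubquotientOfTensorPowers (Y X : C) : Prop :=
  ∃ (n : ℕ) (d : Fin n → ℕ), IsSubquotient Y (⨁ fun i => tensorPow X (d i))

/-- `X` is a generator: every object is a subquotient of a (finite) direct sum of tensor products
of `X` and its iterated duals. -/
def IsGenerator [RigidCategory C] (X : C) : Prop :=
  ∀ Y : C, ∃ (n : ℕ) (L : Fin n → List C),
    (∀ i, ∀ Z ∈ L i, IsIteratedDual X Z) ∧ IsSubquotient Y (⨁ fun i => tensorList (L i))

/-- A tensor category over the field `k`: a locally finite `k`-linear abelian rigid monoidal
category with bilinear tensor product, in which the endomorphism algebra of the unit is `k`.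
Locally finite means that Hom spaces are finite dimensional and every object has finite length
(is both Noetherian and Artinian). -/
class IsTensorCategory (k : Type*) [Field k] (C : Type u) [Category.{v} C] [Abelian C]
    [Linear k C] [MonoidalCategory C] [MonoidalPreadditive C] [MonoidalLinear k C]
    [RigidCategory C] : Prop where
  finite_hom : ∀ X Y : C, Module.Finite k (X ⟶ Y)
  noetherian : ∀ X : C, IsNoetherianObject X
  artinian : ∀ X : C, IsArtinianObject X
  end_unit : Nonempty (End (𝟙_ C) ≃ₐ[k] k)

end Tensor

end TensorCat

universe v u

namespace TensorCat

/-! ### Nonnegative integer matrices and their directed graphs -/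

section Matrix

open Finset

variable {I : Type*} [Fintype I] [DecidableEq I]

/-! Use the Grothendieck ring with its basis of simple classes, finite by hypothesis. Left
multiplication by a simple `V` gives a matrix over `ℕ`, read as a directed graph with an edge from
`s` to `t` when `s` is a constituent of `V ⊗ t`. The coevaluation embeds `𝟙` in `V ⊗ Vᘁ`, which is
an edge from `𝟙` to `Vᘁ`; a path back from `Vᘁ` to `𝟙` says exactly that `Vᘁ` is a constituent of
some tensor power of `V`. The evaluation does the same for `ᘁV`.

So it is enough that every edge lies on a cycle (`exists_pow_pos_of_commute`). Left multiplication
commutes with the sum of the right multiplications by all simples, whose entries are positive.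
Hence, in each power of the matrix, all row and column sums are comparable with uniform constants.
If an edge lay on no cycle, a walk could cross it only once, and counting walks of length `n + 1` by
the moment of crossing would give at least a constant times `n + 1` times the number of walks of
length `n`. That ratio is bounded, a contradiction.

A general `X` is an extension of `B` by a simple `A`, and then `Xᘁ` is an extension of duals, but
the subcategory need not be closed under extensions. Instead `Xᘁ` is a subquotient of `Aᘁ ⊗ X ⊗ Bᘁ`
(`rightDual_isSubquotient`, `leftDual_isSubquotient`), so induction on length gives rigidity
(`duals_mem`). The statements on tensor powers and generators follow by applying this to the
subquotients of sums of tensor powers of `X`. -/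

omit [DecidableEq I] in
-- Both sums are compared with the `(j, i)` entry of `N * R = R * N`.
lemma rowSum_le_colSum_of_commute {N R : Matrix I I ℕ} (h : N * R = R * N) {K : ℕ}
    (hpos : ∀ i j, 1 ≤ R i j) (hK : ∀ i j, R i j ≤ K) (i j : I) :
    ∑ l, N j l ≤ K * ∑ l, N l i := by
  calc ∑ l, N j l ≤ ∑ l, N j l * R l i :=
        sum_le_sum fun l _ => Nat.le_mul_of_pos_right _ (hpos l i)
    _ = (R * N) j i := by rw [← h, Matrix.mul_apply]
    _ = ∑ l, R j l * N l i := Matrix.mul_apply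
    _ ≤ ∑ l, K * N l i := sum_le_sum fun l _ => Nat.mul_le_mul_right _ (hK j l)
    _ = K * ∑ l, N l i := by rw [mul_sum]

omit [DecidableEq I] in
lemma colSum_le_rowSum_of_commute {N R : Matrix I I ℕ} (h : N * R = R * N) {K : ℕ}
    (hpos : ∀ i j, 1 ≤ R i j) (hK : ∀ i j, R i j ≤ K) (i j : I) :
    ∑ l, N l i ≤ K * ∑ l, N j l := by
  calc ∑ l, N l i ≤ ∑ l, R j l * N l i :=
        sum_le_sum fun l _ => Nat.le_mul_of_pos_left _ (hpos j l)
    _ = (N * R) j i := by rw [h, Matrix.mul_apply]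
    _ = ∑ l, N j l * R l i := Matrix.mul_apply
    _ ≤ ∑ l, N j l * K := sum_le_sum fun l _ => Nat.mul_le_mul_left _ (hK l i)
    _ = K * ∑ l, N j l := by rw [← sum_mul, mul_comm]

/-- The sum of all entries of a matrix. -/
def entrySum (N : Matrix I I ℕ) : ℕ := ∑ i, ∑ j, N i j

omit [DecidableEq I] in
lemma entrySum_mul_le (N N' : Matrix I I ℕ) :
    entrySum (N * N') ≤ entrySum N * entrySum N' := by
  have h : entrySum (N * N') = ∑ l, (∑ i, N i l) * ∑ j, N' l j := by
    simp only [entrySum, Matrix.mul_apply]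
    calc ∑ i, ∑ j, ∑ l, N i l * N' l j = ∑ i, ∑ l, N i l * ∑ j, N' l j := by
          refine sum_congr rfl fun i _ => ?_
          rw [sum_comm]
          simp only [mul_sum]
      _ = _ := by
          rw [sum_comm]
          simp only [sum_mul]
  have h' : entrySum N = ∑ l, ∑ i, N i l := sum_comm
  rw [h, h', sum_mul]
  refine sum_le_sum fun l _ => Nat.mul_le_mul_left _ ?_
  exact single_le_sum (f := fun l => ∑ j, N' l j) (fun _ _ => Nat.zero_le _) (mem_univ l)

/-- Expanding `(N + E) ^ n` and keeping the terms of degree one in `E`. -/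
lemma sum_mul_single_le_pow {N E M : Matrix I I ℕ} (hM : M = N + E) (n : ℕ) (i j : I) :
    ∑ a ∈ range n, (N ^ a * E * N ^ (n - 1 - a)) i j ≤ (M ^ n) i j ∧
      (N ^ n) i j ≤ (M ^ n) i j := by
  induction n generalizing i j with
  | zero => simp
  | succ n ih =>
    have hs : ∀ P : Matrix I I ℕ, (M * P) i j = (N * P) i j + (E * P) i j := by
      intro P; rw [hM, add_mul, Matrix.add_apply]
    have hmono : ∀ P Q S : Matrix I I ℕ, (∀ i j, P i j ≤ Q i j) →
        (S * P) i j ≤ (S * Q) i j := by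
      intro P Q S h
      simp only [Matrix.mul_apply]
      exact sum_le_sum fun l _ => Nat.mul_le_mul_left _ (h l j)
    constructor
    -- In `(N + E) * M ^ n` the terms with `a ≥ 1` come from `N`, and the term `a = 0` from `E`
    -- together with the second claim.
    · rw [sum_range_succ', pow_succ' M, hs]
      refine Nat.add_le_add ?_ ?_
      · have := hmono (∑ a ∈ range n, N ^ a * E * N ^ (n - 1 - a)) (M ^ n) N (fun i j => by
          rw [Matrix.sum_apply]; exact (ih i j).1)
        refine le_trans (le_of_eq ?_) this
        rw [mul_sum, Matrix.sum_apply]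
        refine sum_congr rfl fun a _ => ?_
        rw [pow_succ', ← mul_assoc, ← mul_assoc]
        rw [show n + 1 - 1 - (a + 1) = n - 1 - a by omega]
      · simp only [pow_zero, one_mul, Nat.add_sub_cancel, Nat.sub_zero]
        exact hmono _ _ E fun i j => (ih i j).2
    · rw [pow_succ' N, pow_succ' M, hs]
      exact (hmono _ _ N fun i j => (ih i j).2).trans (Nat.le_add_right _ _)

/-- If a matrix `M` of natural numbers commutes with a matrix with positive entries, then
every edge of the directed graph of `M` lies on a directed cycle. -/
theorem exists_pow_pos_of_commute {M R : Matrix I I ℕ} (h : Commute M R)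
    (hpos : ∀ i j, 1 ≤ R i j) {s t : I} (hst : 0 < M s t) : ∃ n : ℕ, 0 < (M ^ n) t s := by
  by_contra! hzero
  simp only [nonpos_iff_eq_zero] at hzero
  obtain ⟨K, hK⟩ : ∃ K, ∀ i j, R i j ≤ K :=
    ⟨entrySum R, fun i j => (single_le_sum (f := fun j => R i j) (fun _ _ => Nat.zero_le _)
      (mem_univ j)).trans (single_le_sum (f := fun i => ∑ j, R i j) (fun _ _ => Nat.zero_le _)
      (mem_univ i))⟩
  have hcomm : ∀ n, M ^ n * R = R * M ^ n := fun n => (h.pow_left n).eq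
  -- Among walks of length `n`, `c n` counts those ending at `s`, `r n` those starting at `t`, and
  -- `τ n` all of them.
  set c : ℕ → ℕ := fun n => ∑ l, (M ^ n) l s with hc
  set r : ℕ → ℕ := fun n => ∑ l, (M ^ n) t l with hr
  set τ : ℕ → ℕ := fun n => entrySum (M ^ n) with hτ
  set Q := Fintype.card I * K with hQ
  have hτc : ∀ n, τ n ≤ Q * c n := by
    intro n
    calc τ n = ∑ j, ∑ l, (M ^ n) j l := rfl
      _ ≤ ∑ _j : I, K * c n :=
        sum_le_sum fun j _ => rowSum_le_colSum_of_commute (hcomm n) hpos hK s j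
      _ = Q * c n := by rw [sum_const, card_univ, smul_eq_mul, mul_assoc]
  have hτr : ∀ n, τ n ≤ Q * r n := by
    intro n
    calc τ n = ∑ l, ∑ j, (M ^ n) j l := sum_comm
      _ ≤ ∑ _j : I, K * r n :=
        sum_le_sum fun j _ => colSum_le_rowSum_of_commute (hcomm n) hpos hK j t
      _ = Q * r n := by rw [sum_const, card_univ, smul_eq_mul, mul_assoc]
  -- If `τ n > 0`, then `c n > 0`, and a walk ending at `s` extends along the edge to `t`.
  have hτpos : ∀ n, 0 < τ n := by
    have hle : ∀ (N : Matrix I I ℕ) i j, N i j ≤ entrySum N := fun N i j =>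
      (single_le_sum (f := fun j => N i j) (fun _ _ => Nat.zero_le _) (mem_univ j)).trans
        (single_le_sum (f := fun i => ∑ j, N i j) (fun _ _ => Nat.zero_le _) (mem_univ i))
    intro n
    induction n with
    | zero => exact lt_of_lt_of_le (by simp) (hle (M ^ 0) s s)
    | succ n ih =>
      have hcn : 0 < c n := Nat.pos_of_ne_zero fun h0 => by
        have := hτc n
        rw [h0, mul_zero] at this
        omega
      obtain ⟨j, -, hj⟩ := exists_ne_zero_of_sum_ne_zero hcn.ne'
      refine lt_of_lt_of_le ?_ (hle (M ^ (n + 1)) j t)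
      rw [pow_succ, Matrix.mul_apply]
      exact lt_of_lt_of_le (Nat.mul_pos (Nat.pos_of_ne_zero hj) hst)
        (single_le_sum (f := fun l => (M ^ n) j l * M l t) (fun _ _ => Nat.zero_le _) (mem_univ s))
  -- `E` is the edge from `s` to `t`, and `N` is the graph without it.
  set E : Matrix I I ℕ := Matrix.single s t (M s t) with hE
  set N : Matrix I I ℕ := Matrix.of fun i j => if i = s ∧ j = t then 0 else M i j with hN
  have hM : M = N + E := by
    ext i j
    by_cases hij : i = s ∧ j = t
    · obtain ⟨rfl, rfl⟩ := hij
      simp [N, E]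
    · have : ¬ (s = i ∧ t = j) := fun h => hij ⟨h.1.symm, h.2.symm⟩
      simp [N, E, hij, this]
  -- No walk leads from `t` to `s`, so a walk ending at `s` never uses the edge; nor, below, does
  -- one starting at `t`.
  have hcol : ∀ a i, (N ^ a) i s = (M ^ a) i s := by
    intro a
    induction a with
    | zero => simp
    | succ a ih =>
      intro i
      have h1 : M ^ (a + 1) = N * M ^ a + E * M ^ a := by rw [← add_mul, ← hM, pow_succ']
      rw [pow_succ', h1, Matrix.add_apply]
      have : (E * M ^ a) i s = 0 := by
        rw [Matrix.mul_apply]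
        refine sum_eq_zero fun l _ => ?_
        by_cases hl : t = l
        · rw [← hl, hzero, mul_zero]
        · simp [E, hl]
      rw [this, add_zero, Matrix.mul_apply, Matrix.mul_apply]
      exact sum_congr rfl fun l _ => by rw [ih]
  have hrow : ∀ a j, (N ^ a) t j = (M ^ a) t j := by
    intro a
    induction a with
    | zero => simp
    | succ a ih =>
      intro j
      have h1 : M ^ (a + 1) = M ^ a * N + M ^ a * E := by rw [← mul_add, ← hM, pow_succ]
      rw [pow_succ, h1, Matrix.add_apply]
      have : (M ^ a * E) t j = 0 := by
        rw [Matrix.mul_apply]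
        refine sum_eq_zero fun l _ => ?_
        by_cases hl : s = l
        · rw [← hl, hzero, zero_mul]
        · simp [E, hl]
      rw [this, add_zero, Matrix.mul_apply, Matrix.mul_apply]
      exact sum_congr rfl fun l _ => by rw [ih]
  have hprod : ∀ a b i j, (M ^ a) i s * (M ^ b) t j ≤ (N ^ a * E * N ^ b) i j := by
    intro a b i j
    have h1 : (N ^ a * E * N ^ b) i j = (N ^ a) i s * M s t * (N ^ b) t j := by
      rw [Matrix.mul_apply, sum_eq_single t, Matrix.mul_apply, sum_eq_single s]
      · simp [E]
      · intro l _ hl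
        simp [E, hl.symm]
      · simp
      · intro l _ hl
        have : (N ^ a * E) i l = 0 := by
          rw [Matrix.mul_apply]
          exact sum_eq_zero fun m _ => by simp [E, hl.symm]
        rw [this, zero_mul]
      · simp
    rw [h1, hcol, hrow]
    exact Nat.mul_le_mul_right _ (Nat.le_mul_of_pos_right _ hst)
  -- A walk of length `n` whose step after time `a` is the edge consists of a walk of length `a`
  -- into `s` and one of length `n - 1 - a` out of `t`.
  have key : ∀ n, ∑ a ∈ range n, c a * r (n - 1 - a) ≤ τ n := by
    intro n
    calc ∑ a ∈ range n, c a * r (n - 1 - a)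
        = ∑ a ∈ range n, ∑ i, ∑ j, (M ^ a) i s * (M ^ (n - 1 - a)) t j :=
          sum_congr rfl fun a _ => by rw [hc, hr, sum_mul_sum]
      _ = ∑ i, ∑ j, ∑ a ∈ range n, (M ^ a) i s * (M ^ (n - 1 - a)) t j := by
          rw [sum_comm]
          exact sum_congr rfl fun i _ => sum_comm
      _ ≤ τ n := sum_le_sum fun i _ => sum_le_sum fun j _ =>
          (sum_le_sum fun a _ => hprod _ _ _ _).trans (sum_mul_single_le_pow hM n i j).1
  have hlin : ∀ n, (n + 1) * τ n ≤ Q * Q * τ 1 * τ n := by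
    intro n
    calc (n + 1) * τ n = ∑ _a ∈ range (n + 1), τ n := by simp
      _ ≤ ∑ a ∈ range (n + 1), Q * Q * (c a * r (n + 1 - 1 - a)) := by
          refine sum_le_sum fun a ha => ?_
          have ha' : n = a + (n + 1 - 1 - a) := by
            have := mem_range.1 ha
            omega
          calc τ n ≤ τ a * τ (n + 1 - 1 - a) := by
                conv_lhs => rw [ha', hτ]
                simp only [pow_add]
                exact entrySum_mul_le _ _
            _ ≤ (Q * c a) * (Q * r (n + 1 - 1 - a)) := Nat.mul_le_mul (hτc _) (hτr _)
            _ = _ := by ring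
      _ ≤ Q * Q * τ (n + 1) := by
          rw [← mul_sum]
          exact Nat.mul_le_mul_left _ (key (n + 1))
      _ ≤ Q * Q * (τ 1 * τ n) := by
          refine Nat.mul_le_mul_left _ ?_
          simp only [hτ, pow_succ', pow_zero, mul_one]
          exact entrySum_mul_le _ _
      _ = _ := by ring
  -- For `n = Q * Q * τ 1` the inequality becomes `n + 1 ≤ n`.
  have := Nat.le_of_mul_le_mul_right (hlin (Q * Q * τ 1)) (hτpos _)
  omega

end Matrix

/-! ### Jordan-Hölder theory and multiplicities of simple objects -/

section CompositionFactors

variable {C : Type u} [Category.{v} C] [Abelian C]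

lemma shortExact_of_cokernel {A X B : C} (i : A ⟶ X) (p : X ⟶ B) [Mono i] [Epi p]
    (w : i ≫ p = 0) (h : ∀ {Z : C} (g : X ⟶ Z), i ≫ g = 0 → ∃ l : B ⟶ Z, p ≫ l = g) :
    (ShortComplex.mk i p w).ShortExact := by
  refine ShortComplex.ShortExact.mk' (ShortComplex.exact_of_g_is_cokernel _ ?_) ‹_› ‹_›
  exact CokernelCofork.IsColimit.ofπ p w (fun g hg => (h g hg).choose)
    (fun g hg => (h g hg).choose_spec)
    (fun g hg m hm => by rw [← cancel_epi p, hm, (h g hg).choose_spec])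

lemma shortExact_cokernel {A X : C} (i : A ⟶ X) [Mono i] :
    (ShortComplex.mk i (cokernel.π i) (cokernel.condition i)).ShortExact :=
  shortExact_of_cokernel _ _ _ fun g hg => ⟨cokernel.desc i g hg, by simp⟩

lemma shortExact_kernel {X B : C} (p : X ⟶ B) [Epi p] :
    (ShortComplex.mk (kernel.ι p) p (kernel.condition p)).ShortExact :=
  ShortComplex.ShortExact.mk' (ShortComplex.exact_kernel p) inferInstance ‹_›

/-- The set of isomorphism classes of objects. -/
abbrev IsoClass (C : Type u) [Category.{v} C] := Quotient (isIsomorphicSetoid C)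

/-- The isomorphism class of an object. -/
def isoClass (X : C) : IsoClass C := Quotient.mk (isIsomorphicSetoid C) X

omit [Abelian C] in
lemma isoClass_eq_iff {X Y : C} : isoClass X = isoClass Y ↔ Nonempty (X ≅ Y) :=
  Quotient.eq (r := isIsomorphicSetoid C)

/-- `X` has a composition series with factors `m`. -/
inductive HasFactors : C → Multiset (IsoClass C) → Prop
  | zero (X : C) : IsZero X → HasFactors X 0
  | cons {A X B : C} {m : Multiset (IsoClass C)} (i : A ⟶ X) (p : X ⟶ B) (w : i ≫ p = 0) :
      (ShortComplex.mk i p w).ShortExact → Simple A → HasFactors B m →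
      HasFactors X (isoClass A ::ₘ m)

lemma HasFactors.of_iso {X Y : C} (e : X ≅ Y) {m : Multiset (IsoClass C)}
    (h : HasFactors X m) : HasFactors Y m := by
  cases h with
  | zero _ hX => exact .zero _ (hX.of_iso e.symm)
  | cons i p w hS hA hB =>
    refine .cons (i ≫ e.hom) (e.inv ≫ p) (by simp [w]) ?_ hA hB
    exact ShortComplex.shortExact_of_iso (S₁ := ShortComplex.mk i p w)
      (S₂ := ShortComplex.mk (i ≫ e.hom) (e.inv ≫ p) (by simp [w]))
      (ShortComplex.isoMk (Iso.refl _) e (Iso.refl _) (by simp) (by simp)) hS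

/-- The third isomorphism theorem: for `A₁ ⊂ A ⊂ X`, the quotient `X/A₁` is an extension of
`X/A` by `A/A₁`. -/
lemma exists_shortExact_quotient {A₁ A A₂ X B : C} {i₁ : A₁ ⟶ A} {p₁ : A ⟶ A₂}
    {w₁ : i₁ ≫ p₁ = 0} (h₁ : (ShortComplex.mk i₁ p₁ w₁).ShortExact) {i : A ⟶ X} {p : X ⟶ B}
    {w : i ≫ p = 0} (h : (ShortComplex.mk i p w).ShortExact) :
    ∃ (X₂ : C) (q : X ⟶ X₂) (wq : (i₁ ≫ i) ≫ q = 0) (j : A₂ ⟶ X₂) (r : X₂ ⟶ B)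
      (wr : j ≫ r = 0), (ShortComplex.mk (i₁ ≫ i) q wq).ShortExact ∧
      (ShortComplex.mk j r wr).ShortExact := by
  have m1 : Mono i₁ := h₁.mono_f
  have e1 : Epi p₁ := h₁.epi_g
  have m : Mono i := h.mono_f
  have e : Epi p := h.epi_g
  have w' : i₁ ≫ i ≫ cokernel.π (i₁ ≫ i) = 0 := by
    rw [← Category.assoc, cokernel.condition]
  let j : A₂ ⟶ cokernel (i₁ ≫ i) := h₁.exact.desc (i ≫ cokernel.π (i₁ ≫ i)) w'
  have hj : p₁ ≫ j = i ≫ cokernel.π (i₁ ≫ i) := h₁.exact.g_desc _ w'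
  let r : cokernel (i₁ ≫ i) ⟶ B := cokernel.desc _ p (by rw [Category.assoc, w, comp_zero])
  have hr : cokernel.π (i₁ ≫ i) ≫ r = p := cokernel.π_desc _ _ _
  have wr : j ≫ r = 0 := by
    rw [← cancel_epi p₁, ← Category.assoc, hj, Category.assoc, hr, w, comp_zero]
  have mj : Mono j := by
    refine Preadditive.mono_of_cancel_zero _ fun {T} f hf => ?_
    obtain ⟨T', π, hπ, x, hx⟩ := surjective_up_to_refinements_of_epi p₁ f
    have h0 : (x ≫ i) ≫ cokernel.π (i₁ ≫ i) = 0 := by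
      rw [Category.assoc, ← hj, ← Category.assoc, ← hx, Category.assoc, hf, comp_zero]
    have hl := (shortExact_cokernel (i₁ ≫ i)).exact.lift_f (x ≫ i) h0
    rw [← cancel_epi π, hx, comp_zero]
    have : x = (shortExact_cokernel (i₁ ≫ i)).exact.lift (x ≫ i) h0 ≫ i₁ := by
      rw [← cancel_mono i, Category.assoc]
      exact hl.symm
    rw [this, Category.assoc, w₁, comp_zero]
  have er : Epi r := epi_of_epi_fac hr
  refine ⟨_, cokernel.π (i₁ ≫ i), cokernel.condition _, j, r, wr, shortExact_cokernel _, ?_⟩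
  refine shortExact_of_cokernel _ _ _ fun g hg => ?_
  have h0 : i ≫ cokernel.π (i₁ ≫ i) ≫ g = 0 := by
    rw [← Category.assoc, ← hj, Category.assoc, hg, comp_zero]
  refine ⟨h.exact.desc _ h0, ?_⟩
  rw [← cancel_epi (cokernel.π (i₁ ≫ i)), ← Category.assoc, hr]
  exact h.exact.g_desc _ h0

lemma HasFactors.add {A X B : C} {a b : Multiset (IsoClass C)} (hA : HasFactors A a)
    (hB : HasFactors B b) {i : A ⟶ X} {p : X ⟶ B} {w : i ≫ p = 0}
    (h : (ShortComplex.mk i p w).ShortExact) : HasFactors X (a + b) := by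
  induction hA generalizing X with
  | zero A hA =>
    have : IsIso p := h.isIso_g_iff.2 hA
    rw [zero_add]
    exact hB.of_iso (asIso p).symm
  | cons i₁ p₁ w₁ h₁ hs _ ih =>
    obtain ⟨X₂, q, wq, j, r, wr, hq, hjr⟩ := exists_shortExact_quotient h₁ h
    rw [Multiset.cons_add]
    exact .cons _ q wq hq hs (ih hjr)

/-- Noetherian induction on the kernel of a quotient `X ⟶ Y`: dividing `Y` by a simple subobject,
which exists by the Artinian condition, strictly enlarges the kernel. -/
lemma exists_hasFactors [∀ X : C, IsNoetherianObject X] [∀ X : C, IsArtinianObject X] (X : C) :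
    ∃ m, HasFactors X m := by
  suffices h : ∀ (S : Subobject X) (Y : C) (p : X ⟶ Y) [Epi p], kernelSubobject p = S →
      ∃ m, HasFactors Y m from h _ X (𝟙 X) rfl
  intro S
  induction S using WellFoundedGT.induction with
  | _ S ih =>
    intro Y p _ hS
    by_cases hY : IsZero Y
    · exact ⟨0, .zero Y hY⟩
    obtain ⟨A, hA⟩ := exists_simple_subobject hY
    obtain ⟨m, hm⟩ := ih (kernelSubobject (p ≫ cokernel.π A.arrow)) (by
      rw [← hS]
      refine lt_of_le_of_ne (kernelSubobject_comp_le _ _) fun heq => ?_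
      have h0 : (kernelSubobject (p ≫ cokernel.π A.arrow)).arrow ≫ p = 0 := by
        rw [← heq]; exact kernelSubobject_arrow_comp p
      have : A.arrow = 0 := by
        obtain ⟨T, π, hπ, x, hx⟩ := surjective_up_to_refinements_of_epi p A.arrow
        have hx0 : x ≫ p ≫ cokernel.π A.arrow = 0 := by
          rw [← Category.assoc, ← hx, Category.assoc, cokernel.condition, comp_zero]
        rw [← cancel_epi π, hx, comp_zero,
          ← factorThruKernelSubobject_comp_arrow _ x hx0, Category.assoc, h0, comp_zero]
      exact Simple.not_isZero (A : C) (IsZero.of_mono_eq_zero _ this)) _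
      (p ≫ cokernel.π A.arrow) rfl
    exact ⟨_, .cons _ _ _ (shortExact_cokernel A.arrow) hA hm⟩

/-- Two quotients by simple subobjects are isomorphic, with isomorphic subobjects, or have a
common quotient of the complementary kind. -/
lemma simple_subobjects_exchange {A X B A' B' : C} [Simple A] [Simple A'] {i : A ⟶ X}
    {p : X ⟶ B} {w : i ≫ p = 0} (h : (ShortComplex.mk i p w).ShortExact) {i' : A' ⟶ X}
    {p' : X ⟶ B'} {w' : i' ≫ p' = 0} (h' : (ShortComplex.mk i' p' w').ShortExact) :
    (Nonempty (A ≅ A') ∧ Nonempty (B ≅ B')) ∨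
    ∃ (Q : C) (f : A' ⟶ B) (q : B ⟶ Q) (wf : f ≫ q = 0) (f' : A ⟶ B') (q' : B' ⟶ Q)
      (wf' : f' ≫ q' = 0), (ShortComplex.mk f q wf).ShortExact ∧
        (ShortComplex.mk f' q' wf').ShortExact := by
  have m : Mono i := h.mono_f
  have e : Epi p := h.epi_g
  have m' : Mono i' := h'.mono_f
  have e' : Epi p' := h'.epi_g
  by_cases h0 : i' ≫ p = 0
  · left
    let φ := h.exact.lift i' h0
    have hφ : φ ≫ i = i' := h.exact.lift_f i' h0
    have hne : φ ≠ 0 := fun hz => by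
      rw [hz, zero_comp] at hφ
      exact Simple.not_isZero A' (IsZero.of_mono_eq_zero _ hφ.symm)
    have : Mono φ := mono_of_mono_fac hφ
    have hiso : IsIso φ := isIso_of_mono_of_nonzero hne
    have hi : i = inv φ ≫ i' := by rw [← hφ]; simp
    have hip : i ≫ p' = 0 := by rw [hi, Category.assoc, w', comp_zero]
    refine ⟨⟨(asIso φ).symm⟩, ⟨⟨h.exact.desc p' hip, h'.exact.desc p h0, ?_, ?_⟩⟩⟩
    · rw [← cancel_epi p, ← Category.assoc]
      have h1 : p ≫ h.exact.desc p' hip = p' := h.exact.g_desc p' hip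
      have h2 : p' ≫ h'.exact.desc p h0 = p := h'.exact.g_desc p h0
      erw [h1, h2]
      simp
    · rw [← cancel_epi p', ← Category.assoc]
      have h1 : p ≫ h.exact.desc p' hip = p' := h.exact.g_desc p' hip
      have h2 : p' ≫ h'.exact.desc p h0 = p := h'.exact.g_desc p h0
      erw [h2, h1]
      simp
  · right
    have hf : Mono (i' ≫ p) := mono_of_nonzero_from_simple h0
    have h0' : i ≫ p' ≠ 0 := fun hz => by
      let φ := h'.exact.lift i hz
      have hφ : φ ≫ i' = i := h'.exact.lift_f i hz
      have hne : φ ≠ 0 := fun hz => by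
        rw [hz, zero_comp] at hφ
        exact Simple.not_isZero A (IsZero.of_mono_eq_zero _ hφ.symm)
      have : Mono φ := mono_of_mono_fac hφ
      have hiso : IsIso φ := isIso_of_mono_of_nonzero hne
      refine h0 ?_
      have hi : i' = inv φ ≫ i := by rw [← hφ]; simp
      rw [hi, Category.assoc, w, comp_zero]
    have hf' : Mono (i ≫ p') := mono_of_nonzero_from_simple h0'
    have hq0 : i' ≫ p ≫ cokernel.π (i' ≫ p) = 0 := by
      rw [← Category.assoc, cokernel.condition]
    let q' := h'.exact.desc (p ≫ cokernel.π (i' ≫ p)) hq0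
    have hq' : p' ≫ q' = p ≫ cokernel.π (i' ≫ p) := h'.exact.g_desc _ hq0
    have hw : (i ≫ p') ≫ q' = 0 := by
      rw [Category.assoc, hq', ← Category.assoc, w, zero_comp]
    have : Epi q' := epi_of_epi_fac hq'
    refine ⟨_, i' ≫ p, cokernel.π _, cokernel.condition _, i ≫ p', q', hw,
      shortExact_cokernel _, shortExact_of_cokernel _ _ _ fun g hg => ?_⟩
    have hg' : i ≫ p' ≫ g = 0 := by rw [← Category.assoc, hg]
    have h1 : p ≫ h.exact.desc (p' ≫ g) hg' = p' ≫ g := h.exact.g_desc _ hg'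
    refine ⟨cokernel.desc _ (h.exact.desc (p' ≫ g) hg') ?_, ?_⟩
    · rw [Category.assoc]
      erw [h1]
      rw [← Category.assoc, w', zero_comp]
    · rw [← cancel_epi p', ← Category.assoc, hq', Category.assoc, cokernel.π_desc]
      exact h1

/-- The Jordan-Hölder theorem. -/
lemma HasFactors.unique [∀ X : C, IsNoetherianObject X] [∀ X : C, IsArtinianObject X] {X : C}
    {m m' : Multiset (IsoClass C)} (h : HasFactors X m) (h' : HasFactors X m') : m = m' := by
  induction hn : m.card using Nat.strong_induction_on generalizing X m m' with
  | _ n ih =>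
    cases h with
    | zero _ hX =>
      cases h' with
      | zero _ _ => rfl
      | cons i p w hS hA _ =>
        have : Mono i := hS.mono_f
        exact absurd (hX.of_mono i) (Simple.not_isZero _)
    | cons i p w hS hA hB =>
      rename_i A B b
      cases h' with
      | zero _ hX =>
        have : Mono i := hS.mono_f
        exact absurd (hX.of_mono i) (Simple.not_isZero _)
      | cons i' p' w' hS' hA' hB' =>
        rename_i A' B' b'
        rw [Multiset.card_cons] at hn
        rcases simple_subobjects_exchange hS hS' with ⟨e, ⟨e'⟩⟩ |
          ⟨Q, f, q, wf, f', q', wf', hf, hf'⟩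
        · rw [isoClass_eq_iff.2 e, ih b.card (by omega) hB (hB'.of_iso e'.symm) rfl]
        -- Both series are compared with one through the common quotient `Q`. The first comparison
        -- gives the length bound that the second needs.
        · obtain ⟨c, hc⟩ := exists_hasFactors Q
          have h1 := ih b.card (by omega) hB (.cons f q wf hf hA' hc) rfl
          have h2 := ih (isoClass A ::ₘ c).card (by
            rw [h1] at hn
            simp only [Multiset.card_cons] at hn ⊢
            omega) (.cons f' q' wf' hf' hA hc) hB' rfl
          rw [h1, ← h2, Multiset.cons_swap]

variable [∀ X : C, IsNoetherianObject X] [∀ X : C, IsArtinianObject X]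

/-- The multiset of composition factors of an object of finite length. -/
noncomputable def factors (X : C) : Multiset (IsoClass C) := (exists_hasFactors X).choose

lemma hasFactors_factors (X : C) : HasFactors X (factors X) := (exists_hasFactors X).choose_spec

lemma HasFactors.factors_eq {X : C} {m : Multiset (IsoClass C)} (h : HasFactors X m) :
    factors X = m := (hasFactors_factors X).unique h

lemma factors_shortExact {A X B : C} {i : A ⟶ X} {p : X ⟶ B} {w : i ≫ p = 0}
    (h : (ShortComplex.mk i p w).ShortExact) : factors X = factors A + factors B :=
  ((hasFactors_factors A).add (hasFactors_factors B) h).factors_eq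

lemma factors_iso {X Y : C} (e : X ≅ Y) : factors X = factors Y :=
  ((hasFactors_factors Y).of_iso e.symm).factors_eq

lemma factors_simple (V : C) [Simple V] : factors V = {isoClass V} := by
  obtain ⟨Z, hZ⟩ : ∃ Z : C, IsZero Z := ⟨_, isZero_zero C⟩
  refine HasFactors.factors_eq (.cons (B := Z) (𝟙 V) 0 (by simp) ?_ ‹_› (.zero _ hZ))
  have : Epi (0 : V ⟶ Z) := ⟨fun _ _ _ => hZ.eq_of_src _ _⟩
  exact shortExact_of_cokernel _ _ _ fun g hg => ⟨0, by
    rw [comp_zero]; simpa using hg.symm⟩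

lemma factors_mono_le {X Y : C} (i : X ⟶ Y) [Mono i] : factors X ≤ factors Y := by
  rw [factors_shortExact (shortExact_cokernel i)]
  exact Multiset.le_add_right _ _

lemma factors_epi_le {X Y : C} (p : X ⟶ Y) [Epi p] : factors Y ≤ factors X := by
  rw [factors_shortExact (shortExact_kernel p)]
  exact Multiset.le_add_left _ _

omit [Abelian C] [∀ X : C, IsNoetherianObject X] [∀ X : C, IsArtinianObject X] in
lemma IsSubquotient.of_epi {X Y : C} (p : X ⟶ Y) [Epi p] : IsSubquotient Y X :=
  ⟨X, 𝟙 X, p, inferInstance, ‹_›⟩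

omit [Abelian C] [∀ X : C, IsNoetherianObject X] [∀ X : C, IsArtinianObject X] in
lemma IsSubquotient.of_mono {X Y : C} (i : Y ⟶ X) [Mono i] : IsSubquotient Y X :=
  ⟨Y, i, 𝟙 Y, ‹_›, inferInstance⟩

omit [∀ X : C, IsNoetherianObject X] [∀ X : C, IsArtinianObject X] in
lemma IsSubquotient.trans {X Y W : C} (h : IsSubquotient W Y) (h' : IsSubquotient Y X) :
    IsSubquotient W X := by
  obtain ⟨Z, i, p, _, _⟩ := h
  obtain ⟨Z', i', p', _, _⟩ := h'
  exact ⟨pullback p' i, pullback.fst p' i ≫ i', pullback.snd p' i ≫ p, mono_comp _ _,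
    epi_comp _ _⟩

lemma IsSubquotient.factors_le {X Y : C} (h : IsSubquotient Y X) : factors Y ≤ factors X := by
  obtain ⟨Z, i, p, _, _⟩ := h
  exact (factors_epi_le p).trans (factors_mono_le i)

omit [∀ X : C, IsNoetherianObject X] [∀ X : C, IsArtinianObject X] in
lemma HasFactors.exists_simple {X : C} {m : Multiset (IsoClass C)} (h : HasFactors X m)
    {s : IsoClass C} (hs : s ∈ m) : ∃ V : C, Simple V ∧ isoClass V = s ∧ IsSubquotient V X := by
  induction h with
  | zero _ _ => simp at hs
  | cons i p w hS hA _ ih =>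
    have : Mono i := hS.mono_f
    have : Epi p := hS.epi_g
    rcases Multiset.mem_cons.1 hs with rfl | hs
    · exact ⟨_, hA, rfl, .of_mono i⟩
    · obtain ⟨V, hV, rfl, h⟩ := ih hs
      exact ⟨V, hV, rfl, h.trans (.of_epi p)⟩

lemma isoClass_mem_factors_iff {V X : C} [Simple V] :
    isoClass V ∈ factors X ↔ IsSubquotient V X := by
  constructor
  · intro h
    obtain ⟨W, _, hW, hWX⟩ := (hasFactors_factors X).exists_simple h
    obtain ⟨e⟩ := isoClass_eq_iff.1 hW
    exact (IsSubquotient.of_mono e.inv).trans hWX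
  · intro h
    exact Multiset.mem_of_le h.factors_le (by rw [factors_simple]; simp)

lemma factors_eq_zero_iff {X : C} : factors X = 0 ↔ IsZero X := by
  constructor
  · intro h
    have := hasFactors_factors X
    rw [h] at this
    generalize hm : (0 : Multiset (IsoClass C)) = m at this
    cases this with
    | zero _ hX => exact hX
    | cons => exact absurd hm (Multiset.zero_ne_cons)
  · exact fun h => HasFactors.factors_eq (.zero X h)

omit [∀ X : C, IsNoetherianObject X] in
lemma exists_simple_mono {X : C} (hX : ¬ IsZero X) :
    ∃ (V : C) (i : V ⟶ X), Simple V ∧ Mono i := by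
  obtain ⟨A, hA⟩ := exists_simple_subobject hX
  exact ⟨_, A.arrow, hA, inferInstance⟩

variable (C) in
/-- The isomorphism classes of simple objects. -/
def SimpleClass := {s : IsoClass C // ∃ V : C, Simple V ∧ isoClass V = s}

namespace SimpleClass

/-- A simple object in a given class. -/
noncomputable def obj (s : SimpleClass C) : C := s.2.choose

omit [∀ X : C, IsNoetherianObject X] [∀ X : C, IsArtinianObject X] in
instance (s : SimpleClass C) : Simple s.obj := s.2.choose_spec.1

omit [∀ X : C, IsNoetherianObject X] [∀ X : C, IsArtinianObject X] in
lemma isoClass_obj (s : SimpleClass C) : isoClass s.obj = s.1 := s.2.choose_spec.2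

/-- The class of a simple object. -/
def of (V : C) [Simple V] : SimpleClass C := ⟨isoClass V, V, ‹_›, rfl⟩

/-- The chosen object in the class of a simple object. -/
noncomputable def objIso (V : C) [Simple V] : (of V).obj ≅ V :=
  (isoClass_eq_iff.1 (of V).isoClass_obj).some

omit [∀ X : C, IsNoetherianObject X] [∀ X : C, IsArtinianObject X] in
lemma finite (h : FinitelyManySimples C) : Finite (SimpleClass C) := by
  obtain ⟨n, S, hS⟩ := h
  choose f hf using fun s : SimpleClass C => hS s.obj inferInstance
  refine Finite.of_injective f fun s t hst => Subtype.ext ?_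
  rw [← s.isoClass_obj, ← t.isoClass_obj, isoClass_eq_iff]
  exact ⟨(hf s).some ≪≫ eqToIso (congrArg S hst) ≪≫ (hf t).some.symm⟩

end SimpleClass

noncomputable instance : DecidableEq (IsoClass C) := Classical.decEq _

/-- The multiplicity of a simple class as a composition factor. -/
noncomputable def mult (X : C) (s : SimpleClass C) : ℕ := (factors X).count s.1

lemma mult_pos_iff {X : C} {s : SimpleClass C} : 0 < mult X s ↔ IsSubquotient s.obj X := by
  rw [mult, Multiset.count_pos, ← s.isoClass_obj, isoClass_mem_factors_iff]

lemma mult_of_pos_iff {X V : C} [Simple V] :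
    0 < mult X (.of V) ↔ IsSubquotient V X := by
  rw [mult, Multiset.count_pos]
  exact isoClass_mem_factors_iff

lemma mult_iso {X Y : C} (e : X ≅ Y) : mult X = mult Y := by
  funext s
  rw [mult, mult, factors_iso e]

lemma mult_shortExact {A X B : C} {i : A ⟶ X} {p : X ⟶ B} {w : i ≫ p = 0}
    (h : (ShortComplex.mk i p w).ShortExact) (s : SimpleClass C) :
    mult X s = mult A s + mult B s := by
  rw [mult, factors_shortExact h, Multiset.count_add, mult, mult]

lemma mult_isZero {X : C} (h : IsZero X) (s : SimpleClass C) : mult X s = 0 := by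
  rw [mult, factors_eq_zero_iff.2 h, Multiset.count_zero]

lemma mult_obj [DecidableEq (SimpleClass C)] (s t : SimpleClass C) :
    mult s.obj t = if t = s then 1 else 0 := by
  rw [mult, factors_simple, s.isoClass_obj, Multiset.count_singleton]
  have h : t = s ↔ t.1 = s.1 := Subtype.ext_iff
  simp only [h]

/-- An exact functor acts linearly on multiplicities. -/
lemma mult_functor_obj [Fintype (SimpleClass C)] (F : C ⥤ C) [F.PreservesZeroMorphisms]
    [PreservesFiniteLimits F] [PreservesFiniteColimits F] (X : C) (s : SimpleClass C) :
    mult (F.obj X) s = ∑ t, mult (F.obj t.obj) s * mult X t := by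
  classical
  generalize hm : factors X = m
  have hX : HasFactors X m := hm ▸ hasFactors_factors X
  clear hm
  induction hX with
  | zero X hX =>
    rw [mult_isZero (F.map_isZero hX)]
    simp [mult_isZero hX]
  | @cons A X B m i p w hS hA hB ih =>
    have hFS := hS.map_of_exact F
    have hA' : ∀ t, mult A t = if t = .of A then 1 else 0 := fun t => by
      rw [← mult_iso (SimpleClass.objIso A), mult_obj]
    rw [mult_shortExact hFS s]
    simp only [mult_shortExact hS, mul_add, Finset.sum_add_distrib, hA', mul_ite, mul_one, mul_zero,
      Finset.sum_ite_eq', Finset.mem_univ, if_true]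
    rw [← ih, mult_iso (F.mapIso (SimpleClass.objIso A))]

end CompositionFactors

/-! ### Exactness of the tensor product, simplicity of the unit, duals of extensions -/

section Monoidal

open ExactPairing

variable {C : Type u} [Category.{v} C] [Abelian C] [MonoidalCategory C] [MonoidalPreadditive C]

section Pairing

variable {X Y : C} [ExactPairing X Y]

omit [Abelian C] [MonoidalPreadditive C] in
lemma tensorLeftHomEquiv_apply (T Z : C) (f : Y ⊗ T ⟶ Z) :
    tensorLeftHomEquiv T X Y Z f = (λ_ T).inv ≫ η_ X Y ▷ T ≫ (α_ X Y T).hom ≫ X ◁ f := rfl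

/-- The duality adjunction is injective and sends `g`, up to a unitor, to `η_ X Y ≫ X ◁ g`. -/
lemma eq_zero_of_coev_whiskerLeft {Q : C} (g : Y ⟶ Q) (h : η_ X Y ≫ X ◁ g = 0) : g = 0 := by
  have h1 : (ρ_ Y).hom ≫ g = (tensorLeftHomEquiv (𝟙_ C) X Y Q).symm (η_ X Y ≫ X ◁ g) :=
    (tensorLeftHomEquiv_symm_coevaluation_comp_whiskerLeft g).symm
  have h2 : (tensorLeftHomEquiv (𝟙_ C) X Y Q).symm (0 : 𝟙_ C ⟶ X ⊗ Q) = 0 := by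
    simp [tensorLeftHomEquiv]
  rw [h, h2] at h1
  rwa [← cancel_epi (ρ_ Y).hom, comp_zero]

lemma eq_zero_of_coev_whiskerRight {Q : C} (g : X ⟶ Q) (h : η_ X Y ≫ g ▷ Y = 0) : g = 0 := by
  have h1 : (tensorRightHomEquiv (𝟙_ C) X Y Q).symm (η_ X Y ≫ g ▷ Y) = (λ_ X).hom ≫ g :=
    tensorRightHomEquiv_symm_coevaluation_comp_whiskerRight g
  have h2 : (tensorRightHomEquiv (𝟙_ C) X Y Q).symm (0 : 𝟙_ C ⟶ Q ⊗ Y) = 0 := by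
    simp [tensorRightHomEquiv]
  rw [h, h2] at h1
  rw [← cancel_epi (λ_ X).hom, comp_zero, ← h1]

variable (X Y) in
lemma coev_ne_zero (h : ¬ IsZero X) : η_ X Y ≠ 0 := fun h0 => by
  refine h ((IsZero.iff_id_eq_zero X).2 ?_)
  exact eq_zero_of_coev_whiskerRight (Y := Y) (𝟙 X) (by rw [h0, zero_comp])

variable (X Y) in
lemma coev_ne_zero' (h : ¬ IsZero Y) : η_ X Y ≠ 0 := fun h0 => by
  refine h ((IsZero.iff_id_eq_zero Y).2 ?_)
  exact eq_zero_of_coev_whiskerLeft (X := X) (𝟙 Y) (by rw [h0, zero_comp])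

variable (X Y) in
lemma ev_ne_zero (h : ¬ IsZero X) : ε_ X Y ≠ 0 := fun h0 => by
  have := evaluation_coevaluation X Y
  rw [h0] at this
  refine h ((IsZero.iff_id_eq_zero X).2 ?_)
  have h1 : (λ_ X).hom ≫ (ρ_ X).inv = 0 := by simpa using this.symm
  simpa using congrArg (fun f => (λ_ X).inv ≫ f ≫ (ρ_ X).hom) h1

end Pairing

section Exactness

variable [RigidCategory C]

instance (X : C) : PreservesFiniteLimits (tensorLeft X) :=
  have := (tensorLeftAdjunction X (Xᘁ)).rightAdjoint_preservesLimits
  inferInstance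

instance (X : C) : PreservesFiniteColimits (tensorLeft X) :=
  have := (tensorLeftAdjunction (ᘁX : C) X).leftAdjoint_preservesColimits
  inferInstance

instance (X : C) : PreservesFiniteLimits (tensorRight X) :=
  have := (tensorRightAdjunction (ᘁX : C) X).rightAdjoint_preservesLimits
  inferInstance

instance (X : C) : PreservesFiniteColimits (tensorRight X) :=
  have := (tensorRightAdjunction X (Xᘁ)).leftAdjoint_preservesColimits
  inferInstance

instance whiskerLeft_mono (X : C) {Y Z : C} (f : Y ⟶ Z) [Mono f] : Mono (X ◁ f) :=
  inferInstanceAs (Mono ((tensorLeft X).map f))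

instance whiskerLeft_epi (X : C) {Y Z : C} (f : Y ⟶ Z) [Epi f] : Epi (X ◁ f) :=
  inferInstanceAs (Epi ((tensorLeft X).map f))

instance whiskerRight_mono (X : C) {Y Z : C} (f : Y ⟶ Z) [Mono f] : Mono (f ▷ X) :=
  inferInstanceAs (Mono ((tensorRight X).map f))

instance whiskerRight_epi (X : C) {Y Z : C} (f : Y ⟶ Z) [Epi f] : Epi (f ▷ X) :=
  inferInstanceAs (Epi ((tensorRight X).map f))

lemma shortExact_whiskerLeft (T : C) {A X B : C} {i : A ⟶ X} {p : X ⟶ B} {w : i ≫ p = 0}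
    (h : (ShortComplex.mk i p w).ShortExact) :
    (ShortComplex.mk (T ◁ i) (T ◁ p)
      (by rw [← whiskerLeft_comp, w, MonoidalPreadditive.whiskerLeft_zero])).ShortExact :=
  h.map_of_exact (tensorLeft T)

lemma shortExact_whiskerRight (T : C) {A X B : C} {i : A ⟶ X} {p : X ⟶ B} {w : i ≫ p = 0}
    (h : (ShortComplex.mk i p w).ShortExact) :
    (ShortComplex.mk (i ▷ T) (p ▷ T)
      (by rw [← comp_whiskerRight, w, MonoidalPreadditive.zero_whiskerRight])).ShortExact :=
  h.map_of_exact (tensorRight T)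

lemma IsSubquotient.tensor {X Y X' Y' : C} (h : IsSubquotient Y X) (h' : IsSubquotient Y' X') :
    IsSubquotient (Y ⊗ Y') (X ⊗ X') := by
  obtain ⟨Z, i, p, _, _⟩ := h
  obtain ⟨Z', i', p', _, _⟩ := h'
  refine ⟨Z ⊗ Z', i ⊗ₘ i', p ⊗ₘ p', ?_, ?_⟩
  · rw [MonoidalCategory.tensorHom_def]; exact mono_comp _ _
  · rw [MonoidalCategory.tensorHom_def]; exact epi_comp _ _

/-- If every nonzero endomorphism of the unit is invertible, the unit is simple. -/
lemma simple_unit (h : ∀ f : 𝟙_ C ⟶ 𝟙_ C, f ≠ 0 → IsIso f) (h0 : ¬ IsZero (𝟙_ C))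
    [∀ X : C, IsArtinianObject X] : Simple (𝟙_ C) := by
  obtain ⟨X, i, hX, hi⟩ := exists_simple_mono h0
  -- This map is the mate of the mono `i`, hence epi.
  have hj : Epi (η_ X (Xᘁ) ≫ i ▷ Xᘁ) := by
    refine Preadditive.epi_of_cancel_zero _ fun {Q} g hg => ?_
    let g' : Xᘁ ⟶ Q := (λ_ (Xᘁ)).inv ≫ g
    have hg' : g = (λ_ (Xᘁ)).hom ≫ g' := by simp [g']
    have : g' = 0 := by
      refine eq_zero_of_coev_whiskerLeft (X := X) g' ?_
      rw [← cancel_mono (i ▷ Q), Category.assoc, whisker_exchange, zero_comp,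
        ← cancel_mono (λ_ Q).hom, zero_comp]
      rw [hg'] at hg
      simpa using hg
    rw [hg', this, comp_zero]
  have : Epi (i ▷ Xᘁ) := epi_of_epi (η_ X (Xᘁ)) _
  have hiso : IsIso (i ▷ Xᘁ) := isIso_of_mono_of_epi _
  have hcoev : Epi (η_ X (Xᘁ)) := by
    have : η_ X (Xᘁ) = (η_ X (Xᘁ) ≫ i ▷ Xᘁ) ≫ inv (i ▷ Xᘁ) := by simp
    rw [this]
    exact epi_comp _ _
  have hcX : Epi (η_ X (Xᘁ) ≫ i ▷ Xᘁ ≫ (λ_ (Xᘁ)).hom) := by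
    rw [← Category.assoc]; exact epi_comp _ _
  let e : X ⟶ X ⊗ Xᘁ := (ρ_ X).inv ≫ X ◁ (η_ X (Xᘁ) ≫ i ▷ Xᘁ ≫ (λ_ (Xᘁ)).hom)
  have he : Epi e := epi_comp _ _
  have hXX : ¬ IsZero (X ⊗ Xᘁ) := fun hz =>
    coev_ne_zero X (Xᘁ) (Simple.not_isZero X) (hz.eq_of_tgt _ _)
  have hne : e ≠ 0 := fun hz => hXX (IsZero.of_epi_eq_zero e hz)
  have : IsIso e := isIso_of_epi_of_nonzero hne
  -- Through `X ≅ X ⊗ Xᘁ` the coevaluation yields a nonzero endomorphism of `𝟙` factoring through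
  -- `i`; being invertible, it makes `i` epi.
  have hc : η_ X (Xᘁ) ≫ inv e ≫ i ≠ 0 := fun hz => by
    have h1 : η_ X (Xᘁ) ≫ inv e = 0 := by
      rw [← cancel_mono i, Category.assoc, hz, zero_comp]
    refine coev_ne_zero X (Xᘁ) (Simple.not_isZero X) ?_
    rw [← cancel_mono (inv e), h1, zero_comp]
  have := h _ hc
  have : Epi i := by
    have : Epi ((η_ X (Xᘁ) ≫ inv e) ≫ i) := by rw [Category.assoc]; infer_instance
    exact epi_of_epi (η_ X (Xᘁ) ≫ inv e) i
  have := isIso_of_mono_of_epi i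
  exact Simple.of_iso (asIso i).symm

/-- A nonzero mono `f` into `Vᘁ` has a nonzero mate `V ⟶ ᘁU`, which is mono since `V` is simple;
this forces `f` to be epi. -/
lemma simple_rightDual (V : C) [Simple V] : Simple (Vᘁ) := by
  refine ⟨fun {U} f _ => ⟨fun _ h0 => ?_, fun h0 => ?_⟩⟩
  · have hz : IsZero (Vᘁ) := IsZero.of_epi_eq_zero f h0
    exact coev_ne_zero V (Vᘁ) (Simple.not_isZero V)
      (((tensorLeft V).map_isZero hz).eq_of_tgt _ _)
  · let f' : V ⟶ (ᘁU : C) := @leftAdjointMate _ _ _ U (Vᘁ) _ hasLeftDualRightDual f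
    have hf' : η_ V (Vᘁ) ≫ f' ▷ Vᘁ = η_ (ᘁU : C) U ≫ (ᘁU : C) ◁ f :=
      @coevaluation_comp_leftAdjointMate _ _ _ U (Vᘁ) _ hasLeftDualRightDual f
    have hne : f' ≠ 0 := fun hz => h0 <| by
      refine eq_zero_of_coev_whiskerLeft (X := (ᘁU : C)) f ?_
      rw [← hf', hz, MonoidalPreadditive.zero_whiskerRight, comp_zero]
    have : Mono f' := mono_of_nonzero_from_simple hne
    have : Epi f := Preadditive.epi_of_cancel_zero _ fun {Z} g hg => by
      refine eq_zero_of_coev_whiskerLeft (X := V) g ?_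
      rw [← cancel_mono (f' ▷ Z), Category.assoc, whisker_exchange, ← Category.assoc, hf',
        Category.assoc, ← whiskerLeft_comp, hg, MonoidalPreadditive.whiskerLeft_zero, comp_zero,
        zero_comp]
    exact isIso_of_mono_of_epi f

lemma simple_leftDual (V : C) [Simple V] : Simple (ᘁV : C) := by
  refine ⟨fun {U} f _ => ⟨fun _ h0 => ?_, fun h0 => ?_⟩⟩
  · have hz : IsZero (ᘁV : C) := IsZero.of_epi_eq_zero f h0
    exact coev_ne_zero' (ᘁV : C) V (Simple.not_isZero V)
      (((tensorRight V).map_isZero hz).eq_of_tgt _ _)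
  · let f' : V ⟶ Uᘁ := @rightAdjointMate _ _ _ U (ᘁV : C) _ hasRightDualLeftDual f
    have hf' : η_ (ᘁV : C) V ≫ (ᘁV : C) ◁ f' = η_ U (Uᘁ) ≫ f ▷ Uᘁ :=
      @coevaluation_comp_rightAdjointMate _ _ _ U (ᘁV : C) _ hasRightDualLeftDual f
    have hne : f' ≠ 0 := fun hz => h0 <| by
      refine eq_zero_of_coev_whiskerRight (Y := Uᘁ) f ?_
      rw [← hf', hz, MonoidalPreadditive.whiskerLeft_zero, comp_zero]
    have : Mono f' := mono_of_nonzero_from_simple hne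
    have : Epi f := Preadditive.epi_of_cancel_zero _ fun {Z} g hg => by
      refine eq_zero_of_coev_whiskerRight (Y := V) g ?_
      rw [← cancel_mono (Z ◁ f'), Category.assoc, ← whisker_exchange, ← Category.assoc, hf',
        Category.assoc, ← comp_whiskerRight, hg, MonoidalPreadditive.zero_whiskerRight, comp_zero,
        zero_comp]
    exact isIso_of_mono_of_epi f

variable [Simple (𝟙_ C)]

/-- As `𝟙` is simple, the evaluation `Aᘁ ⊗ A ⟶ 𝟙` is epi, so a map killed by `A` is killed by `𝟙`.
-/
lemma eq_zero_of_whiskerLeft {A Y Z : C} (hA : ¬ IsZero A) (f : Y ⟶ Z) (h : A ◁ f = 0) :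
    f = 0 := by
  have : Epi (ε_ A (Aᘁ)) := epi_of_nonzero_to_simple (ev_ne_zero A (Aᘁ) hA)
  have h1 : (Aᘁ ⊗ A) ◁ f = 0 := by
    rw [tensor_whiskerLeft, h]; simp
  have h2 : 𝟙_ C ◁ f = 0 := by
    rw [← cancel_epi (ε_ A (Aᘁ) ▷ Y), ← whisker_exchange, h1, zero_comp, comp_zero]
  rw [id_whiskerLeft] at h2
  simpa using congrArg (fun f => (λ_ Y).inv ≫ f ≫ (λ_ Z).hom) h2

lemma eq_zero_of_whiskerRight {A Y Z : C} (hA : ¬ IsZero A) (f : Y ⟶ Z) (h : f ▷ A = 0) :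
    f = 0 := by
  have : Mono (η_ A (Aᘁ)) := mono_of_nonzero_from_simple (coev_ne_zero A (Aᘁ) hA)
  have h1 : f ▷ (A ⊗ Aᘁ) = 0 := by
    rw [whiskerRight_tensor, h]; simp
  have h2 : f ▷ 𝟙_ C = 0 := by
    rw [← cancel_mono (Z ◁ η_ A (Aᘁ)), ← whisker_exchange, h1, zero_comp, comp_zero]
  rw [whiskerRight_id] at h2
  simpa using congrArg (fun f => (ρ_ Y).inv ≫ f ≫ (ρ_ Z).hom) h2

/-- For `0 → A → X → B → 0` exact with `A, B ≠ 0`, the right dual of `X` is a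
subquotient of `A* ⊗ X ⊗ B*`. -/
lemma rightDual_isSubquotient {A X B : C} (hA : ¬ IsZero A) (hB : ¬ IsZero B) {i : A ⟶ X} {p : X ⟶ B}
    {w : i ≫ p = 0} (h : (ShortComplex.mk i p w).ShortExact) :
    IsSubquotient (Xᘁ) (Aᘁ ⊗ (X ⊗ Bᘁ)) := by
  have := h.mono_f
  have : Epi p := h.epi_g
  have hT := shortExact_whiskerRight (Xᘁ) h
  have : Mono (i ▷ Xᘁ) := hT.mono_f
  -- The pullback `E` of the coevaluation of `B` embeds in `X ⊗ Bᘁ` by `e` and maps onto `𝟙` by `l`.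
  let e := pullback.fst (p ▷ Bᘁ) (η_ B (Bᘁ))
  let l := pullback.snd (p ▷ Bᘁ) (η_ B (Bᘁ))
  have hel : e ≫ p ▷ Bᘁ = l ≫ η_ B (Bᘁ) := pullback.condition
  have hcoev : η_ B (Bᘁ) ≫ B ◁ pᘁ = η_ X (Xᘁ) ≫ p ▷ Xᘁ := coevaluation_comp_rightAdjointMate p
  -- The two natural maps `E ⟶ X ⊗ Xᘁ` agree in `B ⊗ Xᘁ`, so their difference lands in `A ⊗ Xᘁ`; its
  -- transpose `Aᘁ ⊗ E ⟶ Xᘁ` is the required epi.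
  let δ := e ≫ X ◁ pᘁ - l ≫ η_ X (Xᘁ)
  have hδ : δ ≫ p ▷ Xᘁ = 0 := by
    rw [Preadditive.sub_comp, Category.assoc, Category.assoc, ← hcoev, whisker_exchange,
      ← Category.assoc, hel, Category.assoc, sub_self]
  let φ := hT.exact.lift δ hδ
  have hφ : φ ≫ i ▷ Xᘁ = δ := hT.exact.lift_f δ hδ
  let s := pullback.lift (f := p ▷ Bᘁ) (g := η_ B (Bᘁ)) (i ▷ Bᘁ) 0 (by
    rw [← comp_whiskerRight, w, MonoidalPreadditive.zero_whiskerRight, zero_comp])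
  have hse : s ≫ e = i ▷ Bᘁ := pullback.lift_fst _ _ _
  have hsl : s ≫ l = 0 := pullback.lift_snd _ _ _
  have hsφ : s ≫ φ = A ◁ pᘁ := by
    rw [← cancel_mono (i ▷ Xᘁ), Category.assoc, hφ, Preadditive.comp_sub, ← Category.assoc, hse,
      ← Category.assoc, hsl, zero_comp, sub_zero, whisker_exchange]
  have : Mono (η_ B (Bᘁ)) := mono_of_nonzero_from_simple (coev_ne_zero B (Bᘁ) hB)
  refine ⟨Aᘁ ⊗ pullback (p ▷ Bᘁ) (η_ B (Bᘁ)), Aᘁ ◁ e,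
    (tensorLeftHomEquiv _ A (Aᘁ) (Xᘁ)).symm φ, inferInstance, ?_⟩
  refine Preadditive.epi_of_cancel_zero _ fun {Q} q hq => ?_
  have hφq : φ ≫ A ◁ q = 0 := by
    have := tensorLeftHomEquiv_naturality (Y := A) ((tensorLeftHomEquiv _ A (Aᘁ) (Xᘁ)).symm φ) q
    rw [hq, Equiv.apply_symm_apply] at this
    rw [← this, tensorLeftHomEquiv_apply]
    simp
  -- Restricting `φ` to `A ⊗ Bᘁ` shows that `q` vanishes on the image of `pᘁ`; only the coevaluation
  -- term of `δ` then remains.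
  have hpq : pᘁ ≫ q = 0 := by
    refine eq_zero_of_whiskerLeft hA _ ?_
    rw [whiskerLeft_comp, ← hsφ, Category.assoc, hφq, comp_zero]
  have hlq : l ≫ η_ X (Xᘁ) ≫ X ◁ q = 0 := by
    have h1 : δ ≫ X ◁ q = 0 := by
      rw [← hφ, Category.assoc, ← whisker_exchange, ← Category.assoc, hφq, zero_comp]
    rw [Preadditive.sub_comp, Category.assoc, Category.assoc, ← whiskerLeft_comp, hpq,
      MonoidalPreadditive.whiskerLeft_zero, comp_zero, zero_sub, neg_eq_zero] at h1
    exact h1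
  refine eq_zero_of_coev_whiskerLeft (X := X) q ?_
  rw [← cancel_epi l, hlq, comp_zero]

/-- For `0 → A → X → B → 0` exact with `A, B ≠ 0`, the left dual of `X` is a
subquotient of `*B ⊗ X ⊗ *A`. -/
lemma leftDual_isSubquotient {A X B : C} (hA : ¬ IsZero A) (hB : ¬ IsZero B) {i : A ⟶ X}
    {p : X ⟶ B} {w : i ≫ p = 0} (h : (ShortComplex.mk i p w).ShortExact) :
    IsSubquotient (ᘁX : C) (((ᘁB : C) ⊗ X) ⊗ (ᘁA : C)) := by
  have := h.mono_f
  have : Epi p := h.epi_g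
  have hT := shortExact_whiskerLeft (ᘁX : C) h
  have : Mono ((ᘁX : C) ◁ i) := hT.mono_f
  let e := pullback.fst ((ᘁB : C) ◁ p) (η_ (ᘁB : C) B)
  let l := pullback.snd ((ᘁB : C) ◁ p) (η_ (ᘁB : C) B)
  have hel : e ≫ (ᘁB : C) ◁ p = l ≫ η_ (ᘁB : C) B := pullback.condition
  have hcoev : η_ (ᘁB : C) B ≫ (ᘁp) ▷ B = η_ (ᘁX : C) X ≫ (ᘁX : C) ◁ p :=
    coevaluation_comp_leftAdjointMate p
  let δ := e ≫ (ᘁp) ▷ X - l ≫ η_ (ᘁX : C) X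
  have hδ : δ ≫ (ᘁX : C) ◁ p = 0 := by
    rw [Preadditive.sub_comp, Category.assoc, Category.assoc, ← hcoev, ← whisker_exchange,
      ← Category.assoc, hel, Category.assoc, sub_self]
  let φ := hT.exact.lift δ hδ
  have hφ : φ ≫ (ᘁX : C) ◁ i = δ := hT.exact.lift_f δ hδ
  let s := pullback.lift (f := (ᘁB : C) ◁ p) (g := η_ (ᘁB : C) B) ((ᘁB : C) ◁ i) 0 (by
    rw [← whiskerLeft_comp, w, MonoidalPreadditive.whiskerLeft_zero, zero_comp])
  have hse : s ≫ e = (ᘁB : C) ◁ i := pullback.lift_fst _ _ _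
  have hsl : s ≫ l = 0 := pullback.lift_snd _ _ _
  have hsφ : s ≫ φ = (ᘁp) ▷ A := by
    rw [← cancel_mono ((ᘁX : C) ◁ i), Category.assoc, hφ, Preadditive.comp_sub, ← Category.assoc,
      hse, ← Category.assoc, hsl, zero_comp, sub_zero, whisker_exchange]
  have : Mono (η_ (ᘁB : C) B) := mono_of_nonzero_from_simple (coev_ne_zero' (ᘁB : C) B hB)
  refine ⟨pullback ((ᘁB : C) ◁ p) (η_ (ᘁB : C) B) ⊗ (ᘁA : C), e ▷ (ᘁA : C),
    (tensorRightHomEquiv _ (ᘁA : C) A (ᘁX : C)).symm φ, inferInstance, ?_⟩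
  refine Preadditive.epi_of_cancel_zero _ fun {Q} q hq => ?_
  have hφq : φ ≫ q ▷ A = 0 := by
    have := tensorRightHomEquiv_naturality (Y' := A)
      ((tensorRightHomEquiv _ (ᘁA : C) A (ᘁX : C)).symm φ) q
    rw [hq, Equiv.apply_symm_apply] at this
    rw [← this]
    simp [tensorRightHomEquiv]
  have hpq : (ᘁp) ≫ q = 0 := by
    refine eq_zero_of_whiskerRight hA _ ?_
    rw [comp_whiskerRight, ← hsφ, Category.assoc, hφq, comp_zero]
  have hlq : l ≫ η_ (ᘁX : C) X ≫ q ▷ X = 0 := by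
    have h1 : δ ≫ q ▷ X = 0 := by
      rw [← hφ, Category.assoc, whisker_exchange, ← Category.assoc, hφq, zero_comp]
    rw [Preadditive.sub_comp, Category.assoc, Category.assoc, ← comp_whiskerRight, hpq,
      MonoidalPreadditive.zero_whiskerRight, comp_zero, zero_sub, neg_eq_zero] at h1
    exact h1
  refine eq_zero_of_coev_whiskerRight (Y := X) q ?_
  rw [← cancel_epi l, hlq, comp_zero]

end Exactness

end Monoidal

/-! ### Multiplication matrices on the Grothendieck ring -/

section GrothendieckRing

open ExactPairing

variable {C : Type u} [Category.{v} C] [Abelian C] [MonoidalCategory C] [MonoidalPreadditive C]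
  [RigidCategory C] [∀ X : C, IsNoetherianObject X] [∀ X : C, IsArtinianObject X]

/-- The matrix of left multiplication by `V` on the Grothendieck ring. -/
noncomputable def leftMatrix (V : C) : Matrix (SimpleClass C) (SimpleClass C) ℕ :=
  Matrix.of fun s t => mult (V ⊗ t.obj) s

/-- The matrix of right multiplication by `V` on the Grothendieck ring. -/
noncomputable def rightMatrix (V : C) : Matrix (SimpleClass C) (SimpleClass C) ℕ :=
  Matrix.of fun s t => mult (t.obj ⊗ V) s

variable [Fintype (SimpleClass C)]

lemma mult_tensor_left (V X : C) (s : SimpleClass C) :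
    mult (V ⊗ X) s = ∑ t, leftMatrix V s t * mult X t :=
  mult_functor_obj (tensorLeft V) X s

lemma mult_tensor_right (V X : C) (s : SimpleClass C) :
    mult (X ⊗ V) s = ∑ t, rightMatrix V s t * mult X t :=
  mult_functor_obj (tensorRight V) X s

lemma commute_leftMatrix_rightMatrix (V W : C) :
    Commute (leftMatrix V) (rightMatrix W) := by
  ext s t
  rw [Matrix.mul_apply, Matrix.mul_apply]
  have h1 := mult_tensor_left V (t.obj ⊗ W) s
  have h2 := mult_tensor_right W (V ⊗ t.obj) s
  rw [mult_iso (α_ V t.obj W)] at h2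
  exact h1.symm.trans h2

variable [Simple (𝟙_ C)]

/-- Since `s` embeds in `t ⊗ (tᘁ ⊗ s)`, some constituent `u` of `tᘁ ⊗ s` has `s` as a constituent of
`t ⊗ u`. -/
lemma exists_rightMatrix_pos (s t : SimpleClass C) : ∃ u : SimpleClass C,
    0 < rightMatrix u.obj s t := by
  have : Mono (η_ t.obj (t.objᘁ)) :=
    mono_of_nonzero_from_simple (coev_ne_zero _ _ (Simple.not_isZero _))
  have hs : 0 < mult (t.obj ⊗ (t.objᘁ ⊗ s.obj)) s := mult_pos_iff.2
    (.of_mono ((λ_ s.obj).inv ≫ η_ t.obj (t.objᘁ) ▷ s.obj ≫ (α_ _ _ _).hom))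
  rw [mult_tensor_left] at hs
  obtain ⟨u, -, hu⟩ := Finset.exists_ne_zero_of_sum_ne_zero hs.ne'
  exact ⟨u, Nat.pos_of_ne_zero (left_ne_zero_of_mul hu)⟩

variable [DecidableEq (SimpleClass C)]

lemma mult_tensorPow (V : C) (n : ℕ) (s : SimpleClass C) :
    mult (tensorPow V n) s = (leftMatrix V ^ n) s (.of (𝟙_ C)) := by
  induction n generalizing s with
  | zero =>
    change mult (𝟙_ C) s = _
    rw [← mult_iso (SimpleClass.objIso (𝟙_ C)), mult_obj, pow_zero, Matrix.one_apply]
  | succ n ih =>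
    change mult (V ⊗ tensorPow V n) s = _
    rw [mult_tensor_left, pow_succ', Matrix.mul_apply]
    simp only [ih]

/-- Reachability of simple objects under tensoring with `V` is symmetric. -/
lemma exists_leftMatrix_pow_pos (V : C) {s t : SimpleClass C} (h : 0 < leftMatrix V s t) :
    ∃ n : ℕ, 0 < (leftMatrix V ^ n) t s := by
  refine exists_pow_pos_of_commute (R := ∑ u : SimpleClass C, rightMatrix u.obj)
    (Commute.sum_right _ _ _ fun u _ => commute_leftMatrix_rightMatrix V u.obj) ?_ h
  intro i j
  obtain ⟨u, hu⟩ := exists_rightMatrix_pos i j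
  rw [Matrix.sum_apply]
  exact hu.trans_le (Finset.single_le_sum (f := fun u : SimpleClass C => rightMatrix u.obj i j)
    (fun _ _ => Nat.zero_le _) (Finset.mem_univ u))

omit [Fintype (SimpleClass C)] [DecidableEq (SimpleClass C)] [Simple (𝟙_ C)]
  [MonoidalPreadditive C] [RigidCategory C] in
lemma leftMatrix_of_pos_iff (V S T : C) [Simple S] [Simple T] :
    0 < leftMatrix V (.of S) (.of T) ↔ IsSubquotient S (V ⊗ T) := by
  rw [← mult_of_pos_iff, ← mult_iso (whiskerLeftIso V (SimpleClass.objIso T))]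
  rfl

omit [Fintype (SimpleClass C)] [DecidableEq (SimpleClass C)] in
/-- A simple object `W` with `𝟙` a constituent of `V ⊗ W` is a constituent of a tensor power
of `V`. -/
lemma exists_isSubquotient_tensorPow (hfin : FinitelyManySimples C) (V W : C) [Simple W]
    (h : IsSubquotient (𝟙_ C) (V ⊗ W)) : ∃ n : ℕ, IsSubquotient W (tensorPow V n) := by
  classical
  have := SimpleClass.finite hfin
  have := Fintype.ofFinite (SimpleClass C)
  obtain ⟨n, hn⟩ := exists_leftMatrix_pow_pos V ((leftMatrix_of_pos_iff V (𝟙_ C) W).2 h)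
  exact ⟨n, by rwa [← mult_of_pos_iff, mult_tensorPow]⟩

omit [Fintype (SimpleClass C)] [DecidableEq (SimpleClass C)] in
-- The edge from `V` to `𝟙` given by `V ≅ V ⊗ 𝟙` closes to a cycle at `𝟙`. The positive exponent
-- allows its use before the unit is known to lie in the subcategory.
lemma exists_unit_isSubquotient_tensorPow (hfin : FinitelyManySimples C) (V : C) [Simple V] :
    ∃ n : ℕ, IsSubquotient (𝟙_ C) (tensorPow V (n + 1)) := by
  classical
  have := SimpleClass.finite hfin
  have := Fintype.ofFinite (SimpleClass C)
  have h := (leftMatrix_of_pos_iff V V (𝟙_ C)).2 (.of_mono (ρ_ V).inv)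
  obtain ⟨n, hn⟩ := exists_leftMatrix_pow_pos V h
  refine ⟨n, ?_⟩
  rw [← mult_of_pos_iff, mult_tensorPow, pow_succ, Matrix.mul_apply]
  exact (Nat.mul_pos hn h).trans_le (Finset.single_le_sum
    (f := fun u => (leftMatrix V ^ n) _ u * leftMatrix V u _) (fun _ _ => Nat.zero_le _)
    (Finset.mem_univ _))

omit [Fintype (SimpleClass C)] [DecidableEq (SimpleClass C)] in
lemma rightDual_isSubquotient_tensorPow (hfin : FinitelyManySimples C) (V : C) [Simple V] :
    ∃ n : ℕ, IsSubquotient (Vᘁ) (tensorPow V n) := by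
  have := simple_rightDual V
  have : Mono (η_ V (Vᘁ)) := mono_of_nonzero_from_simple (coev_ne_zero _ _ (Simple.not_isZero V))
  exact exists_isSubquotient_tensorPow hfin V (Vᘁ) (.of_mono (η_ V (Vᘁ)))

omit [Fintype (SimpleClass C)] [DecidableEq (SimpleClass C)] in
lemma leftDual_isSubquotient_tensorPow (hfin : FinitelyManySimples C) (V : C) [Simple V] :
    ∃ n : ℕ, IsSubquotient (ᘁV : C) (tensorPow V n) := by
  have := simple_leftDual V
  have : Epi (ε_ (ᘁV : C) V) :=
    epi_of_nonzero_to_simple (ev_ne_zero (ᘁV : C) V (Simple.not_isZero _))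
  exact exists_isSubquotient_tensorPow hfin V (ᘁV : C) (.of_epi (ε_ (ᘁV : C) V))

end GrothendieckRing

/-! ### The subcategory of subquotients of sums of tensor powers -/

section Subcategories

variable {C : Type u} [Category.{v} C] [Abelian C] {P : ObjectProperty C}

omit [Abelian C] in
lemma ClosedUnderSubquotients.of_iso (h : ClosedUnderSubquotients P) {X Y : C} (e : X ≅ Y)
    (hX : P X) : P Y := h X Y hX (.of_mono e.inv)

lemma ClosedUnderSubquotients.of_isZero (h : ClosedUnderSubquotients P)
    (hP : IsAdditiveSubcategory P) {X : C} (hX : IsZero X) : P X := by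
  obtain ⟨Z, hZ, hPZ⟩ := hP.zero
  exact h.of_iso (hZ.iso hX) hPZ

attribute [local instance] Abelian.hasFiniteBiproducts

lemma ClosedUnderSubquotients.biproduct (h : ClosedUnderSubquotients P)
    (hP : IsAdditiveSubcategory P) {n : ℕ} (f : Fin n → C) (hf : ∀ i, P (f i)) : P (⨁ f) := by
  induction n with
  | zero =>
    refine h.of_isZero hP ((IsZero.iff_id_eq_zero _).2 ?_)
    ext i
    exact i.elim0
  | succ n ih =>
    let j : ⨁ f ⟶ f 0 ⊞ ⨁ fun i : Fin n => f i.succ :=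
      biprod.lift (biproduct.π f 0) (biproduct.lift fun i => biproduct.π f i.succ)
    have : Mono j := Preadditive.mono_of_cancel_zero _ fun {Z} g hg => by
      ext i
      refine Fin.cases ?_ (fun i => ?_) i
      · simpa [j] using congrArg (fun k => k ≫ biprod.fst) hg
      · simpa [j] using congrArg (fun k => k ≫ biprod.snd ≫ biproduct.π _ i) hg
    exact h _ _ (hP.biprod _ _ (hf 0) (ih _ fun i => hf i.succ)) (.of_mono j)

variable [MonoidalCategory C]

lemma IsSubquotientOfTensorPowers.of_fintype {X Y : C} {ι : Type} [Fintype ι] (d : ι → ℕ)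
    (h : IsSubquotient Y (⨁ fun i => tensorPow X (d i))) : IsSubquotientOfTensorPowers Y X := by
  let e := Fintype.equivFin ι
  refine ⟨Fintype.card ι, fun i => d (e.symm i), h.trans ?_⟩
  let j : (⨁ fun i => tensorPow X (d i)) ⟶ ⨁ fun i => tensorPow X (d (e.symm i)) :=
    biproduct.lift fun i => biproduct.π (fun i => tensorPow X (d i)) (e.symm i)
  have : Mono j := Preadditive.mono_of_cancel_zero _ fun {Z} g hg => by
    ext i
    obtain ⟨i, rfl⟩ := e.symm.surjective i
    simpa [j] using congrArg (fun k => k ≫ biproduct.π _ i) hg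
  exact .of_mono j

lemma isSubquotientOfTensorPowers_tensorPow (X : C) (n : ℕ) :
    IsSubquotientOfTensorPowers (tensorPow X n) X :=
  ⟨1, fun _ => n, .of_mono (biproduct.ι (fun _ : Fin 1 => tensorPow X n) 0)⟩

lemma isSubquotientOfTensorPowers_self (X : C) : IsSubquotientOfTensorPowers X X := by
  obtain ⟨n, d, h⟩ := isSubquotientOfTensorPowers_tensorPow X 1
  exact ⟨n, d, (IsSubquotient.of_mono (ρ_ X).inv).trans h⟩

lemma closedUnderSubquotients_tensorPowers (X : C) :
    ClosedUnderSubquotients fun Y : C => IsSubquotientOfTensorPowers Y X := by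
  rintro Y Z ⟨n, d, h⟩ h'
  exact ⟨n, d, h'.trans h⟩

lemma isAdditiveSubcategory_tensorPowers (X : C) :
    IsAdditiveSubcategory fun Y : C => IsSubquotientOfTensorPowers Y X where
  zero := by
    refine ⟨⨁ fun i : Fin 0 => tensorPow X i.elim0, ?_, 0, _, .of_mono (𝟙 _)⟩
    rw [IsZero.iff_id_eq_zero]
    ext i
    exact i.elim0
  biprod := by
    rintro Y Z ⟨n, d, W, i, p, _, _⟩ ⟨m, d', W', i', p', _, _⟩
    refine .of_fintype (ι := Fin n ⊕ Fin m) (Sum.elim d d') ?_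
    let j : (⨁ fun i => tensorPow X (d i)) ⊞ (⨁ fun i => tensorPow X (d' i)) ⟶
        ⨁ fun i => tensorPow X (Sum.elim d d' i) :=
      biproduct.lift fun k => match k with
        | .inl k => biprod.fst ≫ biproduct.π (fun i => tensorPow X (d i)) k
        | .inr k => biprod.snd ≫ biproduct.π (fun i => tensorPow X (d' i)) k
    have : Mono j := Preadditive.mono_of_cancel_zero _ fun {Z} g hg => by
      have hl : ∀ k, j ≫ biproduct.π (fun i => tensorPow X (Sum.elim d d' i)) (.inl k) =
          biprod.fst ≫ biproduct.π (fun i => tensorPow X (d i)) k := fun k => biproduct.lift_π _ _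
      have hr : ∀ k, j ≫ biproduct.π (fun i => tensorPow X (Sum.elim d d' i)) (.inr k) =
          biprod.snd ≫ biproduct.π (fun i => tensorPow X (d' i)) k := fun k => biproduct.lift_π _ _
      apply biprod.hom_ext
      · refine biproduct.hom_ext _ _ fun k => ?_
        have h0 : (g ≫ j) ≫ biproduct.π (fun i => tensorPow X (Sum.elim d d' i)) (.inl k) = 0 := by
          rw [hg, zero_comp]
        rw [zero_comp, zero_comp, Category.assoc]
        exact (congrArg (g ≫ ·) (hl k)).symm.trans ((Category.assoc _ _ _).symm.trans h0)
      · refine biproduct.hom_ext _ _ fun k => ?_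
        have h0 : (g ≫ j) ≫ biproduct.π (fun i => tensorPow X (Sum.elim d d' i)) (.inr k) = 0 := by
          rw [hg, zero_comp]
        rw [zero_comp, zero_comp, Category.assoc]
        exact (congrArg (g ≫ ·) (hr k)).symm.trans ((Category.assoc _ _ _).symm.trans h0)
    exact ⟨W ⊞ W', biprod.map i i' ≫ j, biprod.map p p', mono_comp _ _, inferInstance⟩

variable [MonoidalPreadditive C]

omit [Abelian C] [MonoidalPreadditive C] in
lemma nonempty_tensorPow_tensor_iso (X : C) (m n : ℕ) :
    Nonempty (tensorPow X m ⊗ tensorPow X n ≅ tensorPow X (m + n)) := by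
  induction m with
  | zero =>
    rw [zero_add]
    exact ⟨λ_ _⟩
  | succ m ih =>
    obtain ⟨e⟩ := ih
    rw [Nat.succ_add]
    exact ⟨α_ X (tensorPow X m) (tensorPow X n) ≪≫ whiskerLeftIso X e⟩

lemma closedUnderTensor_tensorPowers [RigidCategory C] (X : C) :
    ClosedUnderTensor fun Y : C => IsSubquotientOfTensorPowers Y X := by
  rintro Y Z ⟨n, d, h⟩ ⟨m, d', h'⟩
  refine .of_fintype (ι := Fin n × Fin m) (fun k => d k.1 + d' k.2) ((h.tensor h').trans ?_)
  let f := fun i => tensorPow X (d i)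
  let f' := fun i => tensorPow X (d' i)
  have e : ∀ k : Fin n × Fin m, f k.1 ⊗ f' k.2 ≅ tensorPow X (d k.1 + d' k.2) :=
    fun k => (nonempty_tensorPow_tensor_iso X _ _).some
  let j : (⨁ f) ⊗ (⨁ f') ⟶ ⨁ fun k : Fin n × Fin m => tensorPow X (d k.1 + d' k.2) :=
    biproduct.lift fun k => (biproduct.π f k.1 ⊗ₘ biproduct.π f' k.2) ≫ (e k).hom
  have : Mono j := Preadditive.mono_of_cancel_zero _ fun {Z} g hg => by
    have h0 : ∀ i i', g ≫ (biproduct.π f i ⊗ₘ biproduct.π f' i') = 0 := fun i i' => by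
      rw [← cancel_mono (e (i, i')).hom]
      simpa [j] using congrArg (fun k => k ≫ biproduct.π _ (i, i')) hg
    -- Bilinearity decomposes the identity over pairs of summands, so the tensored projections are
    -- jointly monic.
    have h1 : 𝟙 ((⨁ f) ⊗ (⨁ f')) = ∑ i, ∑ i', (biproduct.π f i ⊗ₘ biproduct.π f' i') ≫
        (biproduct.ι f i ⊗ₘ biproduct.ι f' i') := by
      have hf : ∑ i, biproduct.π f i ≫ biproduct.ι f i = 𝟙 (⨁ f) := biproduct.total
      have hf' : ∑ i, biproduct.π f' i ≫ biproduct.ι f' i = 𝟙 (⨁ f') := biproduct.total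
      rw [← id_tensorHom_id, ← hf, ← hf', sum_tensor]
      simp only [tensor_sum, MonoidalCategory.tensorHom_comp_tensorHom]
    rw [← Category.comp_id g, h1, Preadditive.comp_sum]
    refine Finset.sum_eq_zero fun i _ => ?_
    rw [Preadditive.comp_sum]
    exact Finset.sum_eq_zero fun i' _ => by rw [← Category.assoc, h0, zero_comp]
  exact .of_mono j

end Subcategories

/-! ### Rigidity by induction on length, and generators -/

section Rigidity

variable {C : Type u} [Category.{v} C] [Abelian C] [MonoidalCategory C] [MonoidalPreadditive C]
  [RigidCategory C] {P : ObjectProperty C}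

lemma isZero_rightDual {X : C} (hX : IsZero X) : IsZero (Xᘁ) := by
  by_contra h
  exact coev_ne_zero' X (Xᘁ) h (((tensorRight (Xᘁ)).map_isZero hX).eq_of_tgt _ _)

lemma isZero_leftDual {X : C} (hX : IsZero X) : IsZero (ᘁX : C) := by
  by_contra h
  exact coev_ne_zero (ᘁX : C) X h (((tensorLeft (ᘁX : C)).map_isZero hX).eq_of_tgt _ _)

omit [Abelian C] [MonoidalPreadditive C] [RigidCategory C] in
lemma ClosedUnderTensor.tensorPow_succ (hT : ClosedUnderTensor P)
    (hS : ClosedUnderSubquotients P) {X : C} (hX : P X) (n : ℕ) : P (tensorPow X (n + 1)) := by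
  induction n with
  | zero => exact hS.of_iso (ρ_ X).symm hX
  | succ n ih => exact hT _ _ hX ih

variable [Simple (𝟙_ C)] [∀ X : C, IsNoetherianObject X] [∀ X : C, IsArtinianObject X]

lemma unit_mem (hfin : FinitelyManySimples C) (hS : ClosedUnderSubquotients P)
    (hT : ClosedUnderTensor P) {X : C} (hX : P X) (h0 : ¬ IsZero X) : P (𝟙_ C) := by
  obtain ⟨V, i, _, _⟩ := exists_simple_mono h0
  obtain ⟨n, hn⟩ := exists_unit_isSubquotient_tensorPow hfin V
  exact hS _ _ (hT.tensorPow_succ hS (hS _ _ hX (.of_mono i)) n) hn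

/-- A topologizing subcategory closed under tensor products is rigid. -/
theorem duals_mem (hfin : FinitelyManySimples C) (hP : IsAdditiveSubcategory P)
    (hS : ClosedUnderSubquotients P) (hT : ClosedUnderTensor P) {X : C} (hX : P X) :
    P (Xᘁ) ∧ P (ᘁX : C) := by
  have hpow : ∀ {V : C} [Simple V], P V → ∀ n, P (tensorPow V n) := fun {V} _ hV n => by
    cases n with
    | zero => exact unit_mem hfin hS hT hV (Simple.not_isZero V)
    | succ n => exact hT.tensorPow_succ hS hV n
  have hsimple : ∀ {V : C} [Simple V], P V → P (Vᘁ) ∧ P (ᘁV : C) := fun {V} _ hV => by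
    obtain ⟨n, hn⟩ := rightDual_isSubquotient_tensorPow hfin V
    obtain ⟨m, hm⟩ := leftDual_isSubquotient_tensorPow hfin V
    exact ⟨hS _ _ (hpow hV n) hn, hS _ _ (hpow hV m) hm⟩
  have hX' := hasFactors_factors X
  generalize factors X = m at hX'
  induction hX' with
  | zero X h =>
    exact ⟨hS.of_isZero hP (isZero_rightDual h), hS.of_isZero hP (isZero_leftDual h)⟩
  | @cons A X B m i p w h hA _ ih =>
    have : Mono i := h.mono_f
    have : Epi p := h.epi_g
    -- The bound for the dual of an extension needs `B` nonzero; otherwise `X` is itself simple.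
    by_cases hB : IsZero B
    · have : IsIso i := h.isIso_f_iff.2 hB
      have : Simple X := Simple.of_iso (asIso i).symm
      exact hsimple hX
    · have hA' := hsimple (hS _ _ hX (.of_mono i))
      have hB' := ih (hS _ _ hX (.of_epi p))
      have hA0 := Simple.not_isZero A
      exact ⟨hS _ _ (hT _ _ hA'.1 (hT _ _ hX hB'.1)) (rightDual_isSubquotient hA0 hB h),
        hS _ _ (hT _ _ (hT _ _ hB'.2 hX) hA'.2) (leftDual_isSubquotient hA0 hB h)⟩

lemma isSubquotientOfTensorPowers_of_isGenerator (hfin : FinitelyManySimples C) {X : C}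
    (hX : IsGenerator X) (Y : C) : IsSubquotientOfTensorPowers Y X := by
  have hP := isAdditiveSubcategory_tensorPowers X
  have hS := closedUnderSubquotients_tensorPowers X
  have hT := closedUnderTensor_tensorPowers X
  have hdual : ∀ Z, IsIteratedDual X Z → IsSubquotientOfTensorPowers Z X := by
    intro Z hZ
    induction hZ with
    | self => exact isSubquotientOfTensorPowers_self X
    | right Z _ ih => exact (duals_mem hfin hP hS hT ih).1
    | left Z _ ih => exact (duals_mem hfin hP hS hT ih).2
  have hlist : ∀ L : List C, (∀ Z ∈ L, IsIteratedDual X Z) →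
      IsSubquotientOfTensorPowers (tensorList L) X := by
    intro L
    induction L with
    | nil => exact fun _ => isSubquotientOfTensorPowers_tensorPow X 0
    | cons Z L ih =>
      intro h
      exact hT _ _ (hdual Z (h Z (by simp))) (ih fun Z' h' => h Z' (by simp [h']))
  obtain ⟨n, L, hL, hY⟩ := hX Y
  exact hS _ _ (hS.biproduct hP _ fun i => hlist _ (hL i)) hY

end Rigidity

lemma IsTensorCategory.simple_unit (k : Type*) [Field k] (C : Type u) [Category.{v} C] [Abelian C]
    [Linear k C] [MonoidalCategory C] [MonoidalPreadditive C] [MonoidalLinear k C]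
    [RigidCategory C] [IsTensorCategory k C] : Simple (𝟙_ C) := by
  have : ∀ X : C, IsArtinianObject X := IsTensorCategory.artinian k
  obtain ⟨e⟩ := IsTensorCategory.end_unit (k := k) (C := C)
  refine TensorCat.simple_unit (fun f hf => ?_) fun h0 => ?_
  · have hne : e f ≠ 0 := fun h => hf (e.injective (h.trans (map_zero e).symm))
    have hu : IsUnit (show End (𝟙_ C) from f) := by
      have : IsUnit (e.symm (e f)) := (IsUnit.mk0 _ hne).map e.symm
      rwa [e.symm_apply_apply] at this
    exact (isUnit_iff_isIso f).1 hu
  · refine one_ne_zero (α := k) ?_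
    rw [← map_one e, show (1 : End (𝟙_ C)) = 0 from h0.eq_of_src _ _, map_zero]

end TensorCat

theorem theoremT {k : Type*} [Field k] {C : Type*} [Category C] [Abelian C] [Linear k C]
    [MonoidalCategory C] [MonoidalPreadditive C] [MonoidalLinear k C] [RigidCategory C]
    [TensorCat.IsTensorCategory k C] (hfin : TensorCat.FinitelyManySimples C) :
    (∀ P : ObjectProperty C, TensorCat.IsAdditiveSubcategory P →
      TensorCat.ClosedUnderSubquotients P → TensorCat.ClosedUnderTensor P →
      (∀ X : C, P X → P (Xᘁ) ∧ P (ᘁX : C)) ∧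
      ((∃ X : C, P X ∧ ¬ IsZero X) → P (𝟙_ C))) ∧
    (∀ X : C, TensorCat.IsSubquotientOfTensorPowers (Xᘁ) X ∧
      TensorCat.IsSubquotientOfTensorPowers (ᘁX : C) X) ∧
    (∀ V : C, Simple V →
      (∃ d : ℕ, TensorCat.IsSubquotient (Vᘁ) (TensorCat.tensorPow V d)) ∧
      (∃ d : ℕ, TensorCat.IsSubquotient (ᘁV : C) (TensorCat.tensorPow V d))) ∧
    (∀ X : C, TensorCat.IsGenerator X →
      ∀ Y : C, TensorCat.IsSubquotientOfTensorPowers Y X) := by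
  have := TensorCat.IsTensorCategory.simple_unit k C
  have : ∀ X : C, IsArtinianObject X := TensorCat.IsTensorCategory.artinian k
  have : ∀ X : C, IsNoetherianObject X := TensorCat.IsTensorCategory.noetherian k
  refine ⟨fun P hP hS hT => ⟨fun X hX => TensorCat.duals_mem hfin hP hS hT hX, ?_⟩, fun X => ?_,
    fun V _ => ⟨TensorCat.rightDual_isSubquotient_tensorPow hfin V,
      TensorCat.leftDual_isSubquotient_tensorPow hfin V⟩,
    fun X hX => TensorCat.isSubquotientOfTensorPowers_of_isGenerator hfin hX⟩
  · rintro ⟨X, hX, h0⟩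
    exact TensorCat.unit_mem hfin hS hT hX h0
  · exact TensorCat.duals_mem hfin (TensorCat.isAdditiveSubcategory_tensorPowers X)
      (TensorCat.closedUnderSubquotients_tensorPowers X)
      (TensorCat.closedUnderTensor_tensorPowers X) (TensorCat.isSubquotientOfTensorPowers_self X)
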